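/- **Theorem 4 (asymptotic convergence of DPP-RL).** Let $\mathcal X$ and $\mathcal A\neq\emptyset$ be finite sets, and consider the discounted Markov decision process with state space $\mathcal X$, action space $\mathcal A$, transition kernel $P(\cdot\mid x,a)$, reward $r:\mathcal X\times\mathcal A\to\mathbb R$ with $|r(x,a)|\le R_{\max}$ for all $(x,a)$, where $R_{\max}>0$, and discount factor $\gamma\in[0,1)$. Put $V_{\max}=R_{\max}/(1-\gamma)$. For a (possibly randomized and history-dependent) policy $\pi$ let $$Q^{\pi}(x,a)=\mathbb E\Big[\sum_{t\ge 0}\gamma^t r(x_t,a_t)\,\Big|\,x_0=x,\ a_0=a\Big],$$ where $x_{t+1}\sim P(\cdot\mid x_t,a_t)$ and the actions $a_1,a_2,\dots$ are drawn from $\pi$, and let $Q^*(x,a)=\sup_\pi Q^\pi(x,a)$, the supremum being over all such policies. Let $\eta>0$ and let $\Psi_0:\mathcal X\times\mathcal A\to\mathbb R$ satisfy $|\Psi_0(x,a)|\le V_{\max}$ for all $(x,a)$. On a probability space let $y_k(x,a)$, for $k=0,1,2,\dots$ and $(x,a)\in\mathcal X\times\mathcal A$, be $\mathcal X$-valued random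 variables such that $y_k(x,a)$ has law $P(\cdot\mid x,a)$ for all $k$ and $(x,a)$, and such that the random families $(y_k(x,a))_{(x,a)}$, $k=0,1,2,\dots$, are independent (no assumption is made on the joint law of the samples within one round $k$). The algorithm DPP-RL defines, for all $k\ge0$ and all $(x,a)$, $$\pi_k(a\mid x)=\frac{\exp(\eta\Psi_k(x,a))}{\sum_{a'\in\mathcal A}\exp(\eta\Psi_k(x,a'))},\qquad (\pi_k\Psi_k)(x)=\sum_{a'\in\mathcal A}\pi_k(a'\mid x)\Psi_k(x,a'),$$ $$\Psi_{k+1}(x,a)=\Psi_k(x,a)+r(x,a)+\gamma\,(\pi_k\Psi_k)(y_k(x,a))-(\pi_k\Psi_k)(x).$$ Then, with probability 1, $$\lim_{k\to\infty}Q^{\pi_k}(x,a)=Q^*(x,a)\qquad\text{for all }(x,a)\in\mathcal X\times\mathcal A,$$ where $Q^{\pi_k}$ is the action-value function of the stationary policy $\pi_k$. -/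

import Mathlib

open MeasureTheory ProbabilityTheory Filter Topology

namespace DPP

/-- A discounted Markov decision process with state space `X` and action space `A`:
a probability kernel `P` for the next state given a state-action pair, a real reward
`r (x, a)` for each state-action pair and a discount factor `γ ∈ [0, 1)`. -/
structure MDP (X A : Type*) [MeasurableSpace X] [MeasurableSpace A] where
  P : Kernel (X × A) X
  isMarkov : IsMarkovKernel P
  r : X × A → ℝ
  γ : ℝ
  γ_nonneg : 0 ≤ γ
  γ_lt_one : γ < 1

/-- A (randomized, history-dependent) policy: the distribution of the first action given the
first state, and, for every `n`, the distribution of the action at time `n + 1` given the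
state-action pairs at times `0, …, n` and the state at time `n + 1`. -/
structure Policy (X A : Type*) [MeasurableSpace X] [MeasurableSpace A] where
  init : Kernel X A
  next : (n : ℕ) → Kernel ((Finset.Iic n → X × A) × X) A
  isMarkov_init : IsMarkovKernel init
  isMarkov_next : ∀ n, IsMarkovKernel (next n)

section

variable {X A : Type*} [MeasurableSpace X] [MeasurableSpace A]

/-- The stationary Markov policy that draws every action from `π` at the current state. -/
noncomputable def Policy.stationary (π : Kernel X A) [IsMarkovKernel π] : Policy X A where
  init := π
  next _ := π.comap Prod.snd measurable_snd
  isMarkov_init := inferInstance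
  isMarkov_next _ := inferInstance

/-- The conditional law of the state-action pair at time `n + 1` given the pairs at times
`0, …, n`: the next state is drawn from `P` at the pair of time `n`, the next action is then
drawn from the policy. -/
noncomputable def MDP.step (M : MDP X A) (π : Policy X A) (n : ℕ) :
    Kernel (Finset.Iic n → X × A) (X × A) :=
  (M.P.comap (fun h : Finset.Iic n → X × A => h ⟨n, Finset.mem_Iic.2 le_rfl⟩)
    (measurable_pi_apply _)) ⊗ₖ π.next n

instance MDP.isMarkovKernel_step (M : MDP X A) (π : Policy X A) (n : ℕ) :
    IsMarkovKernel (M.step π n) := by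
  have := M.isMarkov
  have := π.isMarkov_next n
  unfold MDP.step
  infer_instance

/-- The law of the whole trajectory of state-action pairs that starts at the pair `z` and
follows the policy `π` from time `1` on. -/
noncomputable def MDP.trajLaw (M : MDP X A) (π : Policy X A) (z : X × A) :
    Measure (ℕ → X × A) :=
  Kernel.traj (X := fun _ => X × A) (M.step π) 0 (fun _ => z)

/-- The action-value function `Q^π`: expected total discounted reward upon choosing the
action `z.2` in the state `z.1` and following `π` afterwards. -/
noncomputable def MDP.Q (M : MDP X A) (π : Policy X A) (z : X × A) : ℝ :=
  ∫ ω, ∑' t : ℕ, M.γ ^ t * M.r (ω t) ∂(M.trajLaw π z)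

/-- The optimal action-value function `Q*`, the supremum of `Q^π` over all policies. -/
noncomputable def MDP.Qstar (M : MDP X A) (z : X × A) : ℝ :=
  ⨆ π : Policy X A, M.Q π z

end

section

variable {X A : Type*} [Fintype A]

/-- The soft-max (Boltzmann) probability of the action `a` in the state `x`. -/
noncomputable def softmax (η : ℝ) (Ψ : X × A → ℝ) (x : X) (a : A) : ℝ :=
  Real.exp (η * Ψ (x, a)) / ∑ a' : A, Real.exp (η * Ψ (x, a'))

theorem softmax_nonneg (η : ℝ) (Ψ : X × A → ℝ) (x : X) (a : A) : 0 ≤ softmax η Ψ x a := by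
  unfold softmax
  positivity

theorem sum_softmax [Nonempty A] (η : ℝ) (Ψ : X × A → ℝ) (x : X) :
    ∑ a, softmax η Ψ x a = 1 := by
  unfold softmax
  rw [← Finset.sum_div]
  exact div_self (Finset.sum_pos (fun a _ => Real.exp_pos _) Finset.univ_nonempty).ne'

/-- The soft-max distribution over actions in the state `x`. -/
noncomputable def softmaxPMF [Nonempty A] (η : ℝ) (Ψ : X × A → ℝ) (x : X) : PMF A :=
  PMF.ofFintype (fun a => ENNReal.ofReal (softmax η Ψ x a)) (by
    rw [← ENNReal.ofReal_sum_of_nonneg (fun a _ => softmax_nonneg η Ψ x a),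
      sum_softmax, ENNReal.ofReal_one])

/-- The soft-max policy associated with the action preferences `Ψ`, as a kernel. -/
noncomputable def softmaxKernel [Nonempty A] [MeasurableSpace A] [MeasurableSpace X]
    [DiscreteMeasurableSpace X] (η : ℝ) (Ψ : X × A → ℝ) : Kernel X A where
  toFun x := (softmaxPMF η Ψ x).toMeasure
  measurable' := Measurable.of_discrete

instance isMarkovKernel_softmaxKernel [Nonempty A] [MeasurableSpace A] [MeasurableSpace X]
    [DiscreteMeasurableSpace X] (η : ℝ) (Ψ : X × A → ℝ) :
    IsMarkovKernel (softmaxKernel η Ψ) :=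
  ⟨fun x => PMF.toMeasure.isProbabilityMeasure (softmaxPMF η Ψ x)⟩

/-- The stationary policy `π` with `π(a|x)` equal to the soft-max probability of `a` in `x`. -/
noncomputable def softmaxPolicy [Nonempty A] [MeasurableSpace A] [MeasurableSpace X]
    [DiscreteMeasurableSpace X] (η : ℝ) (Ψ : X × A → ℝ) : Policy X A :=
  Policy.stationary (softmaxKernel η Ψ)

/-- The average `(πΨ)(x)` of `Ψ (x, ·)` under its own soft-max policy `π`. -/
noncomputable def softmaxAvg (η : ℝ) (Ψ : X × A → ℝ) (x : X) : ℝ :=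
  ∑ a : A, softmax η Ψ x a * Ψ (x, a)

/-- The action preferences generated by the sampled dynamic policy programming recursion,
`y k z` being the next state that is sampled for the state-action pair `z` at round `k`. -/
noncomputable def prefs [MeasurableSpace X] [MeasurableSpace A] (M : MDP X A) (η : ℝ)
    (Ψ₀ : X × A → ℝ) (y : ℕ → X × A → X) : ℕ → X × A → ℝ
  | 0 => Ψ₀
  | k + 1 => fun z =>
      prefs M η Ψ₀ y k z
        + (M.r z + M.γ * softmaxAvg η (prefs M η Ψ₀ y k) (y k z))
        - softmaxAvg η (prefs M η Ψ₀ y k) z.1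

end

end DPP

set_option linter.unusedSectionVars false

/-! Soft-max weights do not change when a function of the state is subtracted from the preferences.
Up to such a function, Ψ_k equals the accumulated updates U_k (`cumUpdate`), so both give the same
policy, and the averages (π_jΨ_j)(x), j ≤ k, sum to the soft-max average of U_k (`sum_prefsAvg`).
Hence U_{k+1} = Ψ₀ + (k+1) r + γ P(soft-max average of U_k) + γ E_{k+1}, with E the accumulated
sampling noise.

The soft-max average is within |A|/η of the maximum, whatever the size of U_k. For a fixed point q
of the Bellman operator, this makes ‖U_k - k q‖ contract by γ in each round, up to a constant and
‖E_{k+1}‖ (`norm_cumUpdate_succ_sub_le`). The averages π_kΨ_k are uniformly bounded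
(`abs_prefsAvg_le`), so the noise has bounded martingale differences and E_k/k → 0 almost surely
(`ae_tendsto_average_zero`). Thus U_k/k → q.

A soft-max policy for preferences near k q is greedy for q up to an error that vanishes after
division by k, so Q^{π_k} → q. Every policy has Q^π ≤ q, so this limit also identifies q with Q*. -/

namespace DPP

/-! ### Action values and one-step lookahead -/

section Values

variable {X A : Type*} [Fintype X] [Fintype A]
  [MeasurableSpace X] [DiscreteMeasurableSpace X]
  [MeasurableSpace A] [DiscreteMeasurableSpace A]

instance isProbabilityMeasure_trajLaw (M : MDP X A) (π : Policy X A) (z : X × A) :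
    IsProbabilityMeasure (M.trajLaw π z) := by
  unfold MDP.trajLaw
  infer_instance

theorem integrable_trajLaw_eval (M : MDP X A) (π : Policy X A) (z : X × A) (n : ℕ)
    (f : X × A → ℝ) : Integrable (fun ω => f (ω n)) (M.trajLaw π z) := by
  have h : Integrable f ((M.trajLaw π z).map (fun ω => ω n)) := .of_finite
  exact h.comp_measurable (measurable_pi_apply n)

theorem integral_trajLaw_zero (M : MDP X A) (π : Policy X A) (z : X × A) (f : X × A → ℝ) :
    ∫ ω, f (ω 0) ∂(M.trajLaw π z) = f z := by
  have h := Kernel.traj_map_frestrictLe_apply (X := fun _ => X × A) (κ := M.step π) 0 0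
    (fun _ => z)
  rw [Kernel.partialTraj_self, Kernel.id_apply] at h
  have h2 : ∫ ω, f (ω 0) ∂(M.trajLaw π z) =
      ∫ u, f (u ⟨0, Finset.mem_Iic.2 le_rfl⟩)
        ∂((M.trajLaw π z).map (Preorder.frestrictLe (π := fun _ => X × A) 0)) := by
    rw [integral_map (by fun_prop) (Measurable.of_discrete.aestronglyMeasurable)]
    rfl
  rw [h2, MDP.trajLaw, h, integral_dirac]

theorem integral_trajLaw_succ (M : MDP X A) (π : Policy X A) (z : X × A) (n : ℕ)
    (f : X × A → ℝ) :
    ∫ ω, f (ω (n + 1)) ∂(M.trajLaw π z) =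
      ∫ ω, ∫ w, f w ∂(M.step π n (Preorder.frestrictLe (π := fun _ => X × A) n ω))
        ∂(M.trajLaw π z) := by
  have h := Kernel.partialTraj_compProd_eq_map_traj (X := fun _ => X × A) (κ := M.step π)
    (Nat.zero_le n) (x₀ := fun _ => z)
  have h1 : ∫ ω, f (ω (n + 1)) ∂(M.trajLaw π z) =
      ∫ p, f p.2 ∂((M.trajLaw π z).map
        (fun ω => (Preorder.frestrictLe (π := fun _ => X × A) n ω, ω (n + 1)))) := by
    rw [integral_map (by fun_prop) (Measurable.of_discrete.aestronglyMeasurable)]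
  rw [h1, MDP.trajLaw, ← h, Measure.integral_compProd Integrable.of_finite,
    ← Kernel.traj_map_frestrictLe_apply,
    integral_map (by fun_prop) (Measurable.of_discrete.aestronglyMeasurable)]

theorem integral_step (M : MDP X A) (π : Policy X A) (n : ℕ) (h : Finset.Iic n → X × A)
    (f : X × A → ℝ) :
    ∫ w, f w ∂(M.step π n h) =
      ∫ x, ∫ a, f (x, a) ∂(π.next n (h, x)) ∂(M.P (h ⟨n, Finset.mem_Iic.2 le_rfl⟩)) := by
  have := M.isMarkov
  have := π.isMarkov_next n
  rw [MDP.step, ProbabilityTheory.integral_compProd Integrable.of_finite, Kernel.comap_apply]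

theorem hasSum_Q (M : MDP X A) (π : Policy X A) (z : X × A) :
    HasSum (fun t => M.γ ^ t * ∫ ω, M.r (ω t) ∂(M.trajLaw π z)) (M.Q π z) := by
  obtain ⟨C, hC⟩ : ∃ C, ∀ w, ‖M.r w‖ ≤ C :=
    ⟨∑ w, ‖M.r w‖, fun w => Finset.single_le_sum (f := fun w => ‖M.r w‖)
      (fun _ _ => norm_nonneg _) (Finset.mem_univ w)⟩
  have h := hasSum_integral_of_summable_integral_norm (μ := M.trajLaw π z)
    (F := fun t ω => M.γ ^ t * M.r (ω t))
    (fun t => (integrable_trajLaw_eval M π z t M.r).const_mul _) ?_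
  · simp only [integral_const_mul] at h
    exact h
  · refine Summable.of_nonneg_of_le (fun t => integral_nonneg fun _ => norm_nonneg _) (fun t => ?_)
      ((summable_geometric_of_lt_one M.γ_nonneg M.γ_lt_one).mul_right C)
    have hb : ∀ ω : ℕ → X × A, ‖M.γ ^ t * M.r (ω t)‖ ≤ M.γ ^ t * C := fun ω => by
      rw [norm_mul, norm_pow, Real.norm_of_nonneg M.γ_nonneg]
      exact mul_le_mul_of_nonneg_left (hC _) (pow_nonneg M.γ_nonneg t)
    calc ∫ ω, ‖M.γ ^ t * M.r (ω t)‖ ∂(M.trajLaw π z)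
        ≤ ∫ _, M.γ ^ t * C ∂(M.trajLaw π z) :=
          integral_mono ((integrable_trajLaw_eval M π z t M.r).const_mul _).norm
            (integrable_const _) hb
      _ = M.γ ^ t * C := by simp

/-- The same decision process with the opposite reward. -/
def MDP.neg (M : MDP X A) : MDP X A := { M with r := fun z => - M.r z }

/-- Turns lower bounds for action values into upper bounds. -/
theorem Q_neg (M : MDP X A) (π : Policy X A) (z : X × A) : M.neg.Q π z = - M.Q π z := by
  have h := (hasSum_Q M π z).neg
  refine (hasSum_Q M.neg π z).unique (h.congr_fun ?_)
  intro t
  change M.γ ^ t * ∫ ω, - M.r (ω t) ∂(M.trajLaw π z) = _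
  rw [integral_neg, mul_neg]

/-- A function that is dominated by its one-step lookahead along a policy is a lower bound of the
action-value function of that policy. -/
theorem le_Q_of_le_step (M : MDP X A) (π : Policy X A) (q : X × A → ℝ)
    (hq : ∀ n (h : Finset.Iic n → X × A),
      q (h ⟨n, Finset.mem_Iic.2 le_rfl⟩) ≤
        M.r (h ⟨n, Finset.mem_Iic.2 le_rfl⟩) + M.γ * ∫ w, q w ∂(M.step π n h))
    (z : X × A) : q z ≤ M.Q π z := by
  set a : ℕ → ℝ := fun t => ∫ ω, M.r (ω t) ∂(M.trajLaw π z) with ha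
  set b : ℕ → ℝ := fun t => ∫ ω, q (ω t) ∂(M.trajLaw π z) with hb
  have hstep : ∀ t, b t ≤ a t + M.γ * b (t + 1) := fun t => by
    have hint : Integrable (fun ω => ∫ w, q w
        ∂(M.step π t (Preorder.frestrictLe (π := fun _ => X × A) t ω))) (M.trajLaw π z) :=
      (Integrable.of_finite (μ := (M.trajLaw π z).map (Preorder.frestrictLe (π := fun _ => X × A) t))
        (f := fun h => ∫ w, q w ∂(M.step π t h))).comp_measurable (by fun_prop)
    simp only [ha, hb]
    rw [integral_trajLaw_succ, ← integral_const_mul,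
      ← integral_add (integrable_trajLaw_eval M π z t M.r) (hint.const_mul _)]
    exact integral_mono (integrable_trajLaw_eval M π z t q)
      ((integrable_trajLaw_eval M π z t M.r).add (hint.const_mul _))
      fun ω => hq t (Preorder.frestrictLe (π := fun _ => X × A) t ω)
  -- Unrolling `hstep` n times; the remainder γ^n b_n vanishes because q is bounded.
  have hind : ∀ n, q z ≤ ∑ t ∈ Finset.range n, M.γ ^ t * a t + M.γ ^ n * b n := by
    intro n
    induction n with
    | zero => simp [hb, integral_trajLaw_zero]
    | succ n ih =>
      rw [Finset.sum_range_succ, pow_succ]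
      nlinarith [mul_le_mul_of_nonneg_left (hstep n) (pow_nonneg M.γ_nonneg n)]
  obtain ⟨C, hC⟩ : ∃ C, ∀ w, q w ≤ C :=
    ⟨∑ w, |q w|, fun w => (le_abs_self _).trans (Finset.single_le_sum (f := fun w => |q w|)
      (fun _ _ => abs_nonneg _) (Finset.mem_univ w))⟩
  have hbC : ∀ n, b n ≤ C := fun n => by
    calc b n ≤ ∫ _, C ∂(M.trajLaw π z) :=
          integral_mono (integrable_trajLaw_eval M π z n q) (integrable_const _) fun ω => hC _
      _ = C := by simp
  have hlim : Tendsto (fun n => ∑ t ∈ Finset.range n, M.γ ^ t * a t + M.γ ^ n * C) atTop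
      (𝓝 (M.Q π z + 0 * C)) :=
    (hasSum_Q M π z).tendsto_sum_nat.add
      ((tendsto_pow_atTop_nhds_zero_of_lt_one M.γ_nonneg M.γ_lt_one).mul_const C)
  rw [zero_mul, add_zero] at hlim
  exact ge_of_tendsto' hlim fun n => (hind n).trans
    (add_le_add le_rfl (mul_le_mul_of_nonneg_left (hbC n) (pow_nonneg M.γ_nonneg n)))

/-- A function that dominates its one-step lookahead along a policy is an upper bound of the
action-value function of that policy. -/
theorem Q_le_of_step_le (M : MDP X A) (π : Policy X A) (q : X × A → ℝ)
    (hq : ∀ n (h : Finset.Iic n → X × A),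
      M.r (h ⟨n, Finset.mem_Iic.2 le_rfl⟩) + M.γ * ∫ w, q w ∂(M.step π n h) ≤
        q (h ⟨n, Finset.mem_Iic.2 le_rfl⟩))
    (z : X × A) : M.Q π z ≤ q z := by
  have h := le_Q_of_le_step M.neg π (fun w => - q w) (fun n h => ?_) z
  · rw [Q_neg] at h
    exact neg_le_neg_iff.1 h
  · change _ ≤ - M.r _ + M.γ * ∫ w, - q w ∂(M.step π n h)
    rw [integral_neg]
    linarith [hq n h]

end Values

/-! ### Soft-max versus maximum -/

section Greedy

variable {X A : Type*} [Fintype A] [Nonempty A]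

/-- The maximum of `f (x, ·)` over the actions. -/
noncomputable def maxA (f : X × A → ℝ) (x : X) : ℝ := ⨆ a, f (x, a)

theorem le_maxA (f : X × A → ℝ) (x : X) (a : A) : f (x, a) ≤ maxA f x :=
  le_ciSup (f := fun a => f (x, a)) (Set.finite_range _).bddAbove a

theorem maxA_le {f : X × A → ℝ} {x : X} {c : ℝ} (h : ∀ a, f (x, a) ≤ c) : maxA f x ≤ c :=
  ciSup_le h

theorem abs_maxA_sub_maxA_le {f g : X × A → ℝ} {x : X} {c : ℝ}
    (h : ∀ a, |f (x, a) - g (x, a)| ≤ c) : |maxA f x - maxA g x| ≤ c := by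
  rw [abs_le]
  constructor
  · have : maxA g x ≤ maxA f x + c := maxA_le fun a => by
      linarith [(abs_le.1 (h a)).1, le_maxA f x a]
    linarith
  · have : maxA f x ≤ maxA g x + c := maxA_le fun a => by
      linarith [(abs_le.1 (h a)).2, le_maxA g x a]
    linarith

theorem maxA_mul {f : X × A → ℝ} {c : ℝ} (hc : 0 ≤ c) (x : X) :
    maxA (fun z => c * f z) x = c * maxA f x :=
  (Real.mul_iSup_of_nonneg hc _).symm

theorem sum_softmax_mul_le (η : ℝ) (Ψ f : X × A → ℝ) {x : X} {c : ℝ} (h : ∀ a, f (x, a) ≤ c) :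
    ∑ a, softmax η Ψ x a * f (x, a) ≤ c := by
  calc ∑ a, softmax η Ψ x a * f (x, a) ≤ ∑ a, softmax η Ψ x a * c :=
        Finset.sum_le_sum fun a _ => mul_le_mul_of_nonneg_left (h a) (softmax_nonneg _ _ _ _)
    _ = c := by rw [← Finset.sum_mul, sum_softmax, one_mul]

theorem le_sum_softmax_mul (η : ℝ) (Ψ f : X × A → ℝ) {x : X} {c : ℝ} (h : ∀ a, c ≤ f (x, a)) :
    c ≤ ∑ a, softmax η Ψ x a * f (x, a) := by
  calc c = ∑ a, softmax η Ψ x a * c := by rw [← Finset.sum_mul, sum_softmax, one_mul]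
    _ ≤ _ :=
        Finset.sum_le_sum fun a _ => mul_le_mul_of_nonneg_left (h a) (softmax_nonneg _ _ _ _)

theorem softmaxAvg_le_maxA (η : ℝ) (Ψ : X × A → ℝ) (x : X) : softmaxAvg η Ψ x ≤ maxA Ψ x :=
  sum_softmax_mul_le η Ψ Ψ fun a => le_maxA Ψ x a

/-- An action with gap t below the maximum has weight at most exp(-ηt), and t exp(-ηt) ≤ 1/η. Each
of the |A| actions thus contributes at most 1/η to the mean gap. -/
theorem maxA_le_softmaxAvg {η : ℝ} (hη : 0 < η) (Ψ : X × A → ℝ) (x : X) :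
    maxA Ψ x ≤ softmaxAvg η Ψ x + Fintype.card A / η := by
  obtain ⟨a₀, ha₀⟩ := exists_eq_ciSup_of_finite (f := fun a => Ψ (x, a))
  change Ψ (x, a₀) = maxA Ψ x at ha₀
  have key : ∀ a, softmax η Ψ x a * (maxA Ψ x - Ψ (x, a)) ≤ 1 / η := fun a => by
    set t := maxA Ψ x - Ψ (x, a) with ht
    have ht0 : 0 ≤ t := sub_nonneg.2 (le_maxA Ψ x a)
    have h1 : softmax η Ψ x a ≤ Real.exp (-(η * t)) := by
      rw [softmax, div_le_iff₀ (Finset.sum_pos (fun _ _ => Real.exp_pos _) Finset.univ_nonempty)]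
      calc Real.exp (η * Ψ (x, a)) = Real.exp (-(η * t)) * Real.exp (η * Ψ (x, a₀)) := by
            rw [← Real.exp_add, ha₀]; congr 1; ring
        _ ≤ _ := mul_le_mul_of_nonneg_left
            (Finset.single_le_sum (f := fun a => Real.exp (η * Ψ (x, a)))
              (fun _ _ => (Real.exp_pos _).le) (Finset.mem_univ a₀)) (Real.exp_pos _).le
    have h2 : Real.exp (-(η * t)) * (η * t) ≤ 1 := by
      rw [Real.exp_neg, inv_mul_le_iff₀ (Real.exp_pos _), mul_one]
      linarith [Real.add_one_le_exp (η * t)]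
    rw [le_div_iff₀ hη]
    nlinarith [mul_le_mul_of_nonneg_right h1 (mul_nonneg hη.le ht0)]
  have hsum := Finset.sum_le_sum fun a (_ : a ∈ Finset.univ) => key a
  simp only [mul_sub, Finset.sum_sub_distrib, ← Finset.sum_mul, sum_softmax, one_mul,
    Finset.sum_const, Finset.card_univ, nsmul_eq_mul, mul_one_div] at hsum
  rw [softmaxAvg]
  linarith

theorem softmax_sub (η : ℝ) (Ψ : X × A → ℝ) (c : X → ℝ) (x : X) (a : A) :
    softmax η (fun z => Ψ z - c z.1) x a = softmax η Ψ x a := by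
  simp only [softmax, mul_sub, Real.exp_sub]
  rw [← Finset.sum_div, div_div_div_cancel_right₀ (Real.exp_pos _).ne']

theorem softmaxAvg_sub (η : ℝ) (Ψ : X × A → ℝ) (c : X → ℝ) (x : X) :
    softmaxAvg η (fun z => Ψ z - c z.1) x = softmaxAvg η Ψ x - c x := by
  simp only [softmaxAvg, softmax_sub, mul_sub, Finset.sum_sub_distrib, ← Finset.sum_mul,
    sum_softmax, one_mul]

/-- A soft-max policy for preferences close to `c * f` is nearly greedy with respect to `f`. -/
theorem mul_maxA_le_sum_softmax {η : ℝ} (hη : 0 < η) (Ψ f : X × A → ℝ) {c d : ℝ} (hc : 0 ≤ c)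
    (h : ∀ z, |Ψ z - c * f z| ≤ d) (x : X) :
    c * maxA f x ≤ c * (∑ a, softmax η Ψ x a * f (x, a)) + (2 * d + Fintype.card A / η) := by
  have h1 := abs_maxA_sub_maxA_le (f := Ψ) (g := fun z => c * f z) (x := x) (fun a => h (x, a))
  rw [maxA_mul hc] at h1
  have h2 := maxA_le_softmaxAvg hη Ψ x
  have h3 : softmaxAvg η Ψ x ≤ c * (∑ a, softmax η Ψ x a * f (x, a)) + d := by
    -- The upper half of `h`, averaged under the soft-max weights.
    have := sum_softmax_mul_le η Ψ (fun z => Ψ z - c * f z) (x := x) (c := d)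
      fun a => (abs_le.1 (h (x, a))).2
    simp only [mul_sub, Finset.sum_sub_distrib, mul_left_comm _ c, ← Finset.mul_sum] at this
    rw [softmaxAvg]
    linarith
  linarith [(abs_le.1 h1).1]

theorem integral_softmaxKernel [MeasurableSpace A] [DiscreteMeasurableSpace A]
    [MeasurableSpace X] [DiscreteMeasurableSpace X] (η : ℝ) (Ψ : X × A → ℝ) (x : X) (f : A → ℝ) :
    ∫ a, f a ∂(softmaxKernel η Ψ x) = ∑ a, softmax η Ψ x a * f a := by
  change ∫ a, f a ∂((softmaxPMF η Ψ x).toMeasure) = _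
  rw [PMF.integral_eq_sum]
  refine Finset.sum_congr rfl fun a _ => ?_
  rw [softmaxPMF, PMF.ofFintype_apply, ENNReal.toReal_ofReal (softmax_nonneg _ _ _ _), smul_eq_mul]

end Greedy

/-! ### Bellman optimality operator and near-greedy policies -/

section Bellman

variable {X A : Type*} [Fintype X] [Fintype A] [Nonempty A]
  [MeasurableSpace X] [DiscreteMeasurableSpace X]
  [MeasurableSpace A] [DiscreteMeasurableSpace A]

theorem integral_P_mono (M : MDP X A) (z : X × A) {f g : X → ℝ} (h : ∀ x, f x ≤ g x) :
    ∫ x, f x ∂(M.P z) ≤ ∫ x, g x ∂(M.P z) := by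
  have := M.isMarkov
  exact integral_mono .of_finite .of_finite h

theorem abs_integral_P_sub_le (M : MDP X A) (z : X × A) {f g : X → ℝ} {c : ℝ}
    (h : ∀ x, |f x - g x| ≤ c) : |∫ x, f x ∂(M.P z) - ∫ x, g x ∂(M.P z)| ≤ c := by
  have := M.isMarkov
  rw [← integral_sub .of_finite .of_finite]
  simpa using norm_integral_le_of_norm_le_const (μ := M.P z) (f := fun x => f x - g x)
    (Eventually.of_forall h)

/-- The Bellman optimality operator. -/
noncomputable def MDP.bellman (M : MDP X A) (q : X × A → ℝ) : X × A → ℝ :=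
  fun z => M.r z + M.γ * ∫ x, maxA q x ∂(M.P z)

theorem exists_bellman_fixedPoint (M : MDP X A) : ∃ q, M.bellman q = q := by
  have hc : ContractingWith ⟨M.γ, M.γ_nonneg⟩ M.bellman := by
    refine ⟨by exact_mod_cast M.γ_lt_one, LipschitzWith.of_dist_le_mul fun f g => ?_⟩
    refine (dist_pi_le_iff (mul_nonneg M.γ_nonneg dist_nonneg)).2 fun z => ?_
    rw [Real.dist_eq, MDP.bellman, MDP.bellman, add_sub_add_left_eq_sub, ← mul_sub, abs_mul,
      abs_of_nonneg M.γ_nonneg]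
    refine mul_le_mul_of_nonneg_left (abs_integral_P_sub_le M z fun x => ?_) M.γ_nonneg
    exact abs_maxA_sub_maxA_le fun a => dist_le_pi_dist f g (x, a)
  exact ⟨_, hc.fixedPoint_isFixedPt⟩

/-- An average over actions never exceeds the maximum, however the action depends on the history, so
q dominates its lookahead along any policy. -/
theorem Q_le_of_bellman_eq (M : MDP X A) {q : X × A → ℝ} (hq : M.bellman q = q)
    (π : Policy X A) (z : X × A) : M.Q π z ≤ q z := by
  refine Q_le_of_step_le M π q (fun n h => ?_) z
  conv_rhs => rw [← hq]
  rw [integral_step, MDP.bellman]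
  refine add_le_add le_rfl (mul_le_mul_of_nonneg_left (integral_P_mono M _ fun x => ?_) M.γ_nonneg)
  have := π.isMarkov_next n
  calc ∫ a, q (x, a) ∂(π.next n (h, x)) ≤ ∫ _, maxA q x ∂(π.next n (h, x)) :=
        integral_mono .of_finite .of_finite fun a => le_maxA q x a
    _ = maxA q x := by simp

/-- The value of a soft-max policy that is greedy up to `δ` with respect to the optimal action
values is optimal up to `γ δ / (1 - γ)`. -/
theorem sub_le_Q_softmaxPolicy (M : MDP X A) {q : X × A → ℝ} (hq : M.bellman q = q)
    (η : ℝ) (Ψ : X × A → ℝ) {δ : ℝ}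
    (hδ : ∀ x, maxA q x ≤ ∑ a, softmax η Ψ x a * q (x, a) + δ) (z : X × A) :
    q z - M.γ * δ / (1 - M.γ) ≤ M.Q (softmaxPolicy η Ψ) z := by
  have := M.isMarkov
  have hγ : 1 - M.γ ≠ 0 := (sub_pos.2 M.γ_lt_one).ne'
  -- The solution of c = γδ + γc, which makes q - c a subsolution along the policy.
  set c := M.γ * δ / (1 - M.γ) with hc
  have hc' : c = M.γ * δ + M.γ * c := by rw [hc]; field_simp; ring
  refine le_Q_of_le_step M _ (fun w => q w - c) (fun n h => ?_) z
  set w := h ⟨n, Finset.mem_Iic.2 le_rfl⟩ with hw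
  rw [integral_step, ← hw]
  have h1 : ∀ x, ∫ a, (q (x, a) - c) ∂((softmaxPolicy η Ψ).next n (h, x)) =
      ∑ a, softmax η Ψ x a * q (x, a) - c := fun x => by
    change ∫ a, (q (x, a) - c) ∂(softmaxKernel η Ψ x) = _
    rw [integral_sub .of_finite .of_finite, integral_softmaxKernel]
    simp
  simp only [h1]
  have h2 : ∫ x, (maxA q x - δ - c) ∂(M.P w) ≤
      ∫ x, (∑ a, softmax η Ψ x a * q (x, a) - c) ∂(M.P w) :=
    integral_P_mono M w fun x => by linarith [hδ x]
  have h3 : ∫ x, (maxA q x - δ - c) ∂(M.P w) = ∫ x, maxA q x ∂(M.P w) - δ - c := by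
    rw [integral_sub .of_finite .of_finite, integral_sub .of_finite .of_finite]
    simp
  have h4 : q w = M.r w + M.γ * ∫ x, maxA q x ∂(M.P w) := (congr_fun hq w).symm
  rw [h3] at h2
  have h5 := mul_le_mul_of_nonneg_left h2 M.γ_nonneg
  change q w - c ≤ _
  linarith

end Bellman

/-! ### Strong law for bounded martingale differences -/

section StrongLaw

/-- If the averages of a sequence with bounded increments tend to zero along the perfect squares,
they tend to zero. -/
theorem tendsto_div_of_tendsto_sq {s : ℕ → ℝ} {B : ℝ} (hB : ∀ n, |s (n + 1) - s n| ≤ B)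
    (h : Tendsto (fun n : ℕ => s (n ^ 2) / (n : ℝ) ^ 2) atTop (𝓝 0)) :
    Tendsto (fun n : ℕ => s n / n) atTop (𝓝 0) := by
  have hB0 : 0 ≤ B := (abs_nonneg _).trans (hB 0)
  have hinc : ∀ m k, |s (m + k) - s m| ≤ k * B := fun m k => by
    induction k with
    | zero => simp
    | succ k ih =>
      have := abs_sub_le (s (m + (k + 1))) (s (m + k)) (s m)
      have h2 := hB (m + k)
      rw [add_assoc] at h2
      push_cast
      linarith
  have hs : Tendsto Nat.sqrt atTop atTop :=
    tendsto_atTop_mono' atTop (f₁ := Nat.sqrt) (Eventually.of_forall fun n => le_rfl)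
      (tendsto_atTop_atTop.2 fun b => ⟨b * b, fun a ha => Nat.le_sqrt.2 ha⟩)
  have hbound : Tendsto (fun n : ℕ => |s (n ^ 2) / (n : ℝ) ^ 2| + 2 * B * ((n : ℝ))⁻¹)
      atTop (𝓝 (|0| + 2 * B * 0)) :=
    h.abs.add ((tendsto_inv_atTop_nhds_zero_nat).const_mul _)
  simp only [abs_zero, mul_zero, add_zero] at hbound
  refine squeeze_zero_norm' ?_ (hbound.comp hs)
  filter_upwards [eventually_ge_atTop 1] with n hn
  -- Since m² ≤ n ≤ m² + 2m, s moves by at most 2mB between m² and n; dividing by m² leaves 2B/m.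
  obtain ⟨m, hm⟩ : ∃ m, m = Nat.sqrt n := ⟨_, rfl⟩
  have hm1 : 1 ≤ m := hm ▸ Nat.le_sqrt.2 (by simpa using hn)
  have hmn : m ^ 2 ≤ n := by rw [pow_two, hm]; exact Nat.sqrt_le n
  have hnm : n ≤ m ^ 2 + 2 * m := by have := Nat.sqrt_le_add n; rw [pow_two, hm]; lia
  obtain ⟨k, rfl⟩ := Nat.exists_eq_add_of_le hmn
  have hk : (k : ℝ) ≤ 2 * m := by exact_mod_cast (by lia : k ≤ 2 * m)
  have hmpos : (0 : ℝ) < m := by exact_mod_cast hm1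
  have hle : (m : ℝ) ^ 2 ≤ ((m ^ 2 + k : ℕ) : ℝ) := by exact_mod_cast hmn
  have habs : |s (m ^ 2 + k)| ≤ |s (m ^ 2)| + 2 * m * B := by
    have h1 := hinc (m ^ 2) k
    have h2 := abs_sub_abs_le_abs_sub (s (m ^ 2 + k)) (s (m ^ 2))
    nlinarith [mul_le_mul_of_nonneg_right hk hB0]
  simp only [Function.comp, ← hm]
  rw [Real.norm_eq_abs, abs_div, Nat.abs_cast, abs_div, abs_of_pos (pow_pos hmpos 2)]
  calc |s (m ^ 2 + k)| / ((m ^ 2 + k : ℕ) : ℝ) ≤ (|s (m ^ 2)| + 2 * m * B) / (m : ℝ) ^ 2 :=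
        div_le_div₀ (by positivity) habs (pow_pos hmpos 2) hle
    _ = _ := by field_simp

variable {Ω W : Type*} [MeasurableSpace Ω] {μ : Measure Ω} [IsProbabilityMeasure μ]
  [Finite W] [MeasurableSpace W] [MeasurableSingletonClass W]

/-- The value at an independent sample of a function of the past whose conditional mean is zero
is orthogonal to functions of the past. -/
theorem integral_mul_eq_zero_of_past {Y : ℕ → Ω → W} (hY : ∀ j, Measurable (Y j))
    (hind : iIndepFun Y μ) (n : ℕ) {G : (ℕ → W) → ℝ} {F : (ℕ → W) → W → ℝ}
    (hG : ∀ u v : ℕ → W, (∀ i < n, u i = v i) → G u = G v)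
    (hF : ∀ u v : ℕ → W, (∀ i < n, u i = v i) → F u = F v)
    (hF0 : ∀ u, ∫ ω, F u (Y n ω) ∂μ = 0) :
    ∫ ω, G (fun i => Y i ω) * F (fun i => Y i ω) (Y n ω) ∂μ = 0 := by
  obtain ⟨ω₀⟩ : Nonempty Ω := nonempty_of_isProbabilityMeasure μ
  -- Extends a finite history by an arbitrary constant, invisible to `G` and `F`. The problem moves
  -- to a finite space, where every function is measurable and integrable.
  set e : (Finset.range n → W) → ℕ → W :=
    fun h i => if hi : i ∈ Finset.range n then h ⟨i, hi⟩ else Y 0 ω₀ with he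
  set H : Ω → Finset.range n → W := fun ω i => Y i ω with hH
  have heH : ∀ ω, ∀ i < n, (fun i => Y i ω) i = e (H ω) i := fun ω i hi => by
    simp [he, hH, hi]
  have hHm : Measurable H := measurable_pi_lambda _ fun i => hY i
  have hindep : IndepFun H (Y n) μ := by
    have h1 := hind.indepFun_finset (Finset.range n) {n} (by simp) hY
    exact h1.comp (φ := id) (ψ := fun f : ({n} : Finset ℕ) → W =>
      f ⟨n, Finset.mem_singleton_self n⟩) measurable_id (measurable_pi_apply _)
  have hmap := hindep.map_prod_eq_prod_map_map hHm.aemeasurable (hY n).aemeasurable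
  have : IsProbabilityMeasure (μ.map H) := Measure.isProbabilityMeasure_map hHm.aemeasurable
  have : IsProbabilityMeasure (μ.map (Y n)) :=
    Measure.isProbabilityMeasure_map (hY n).aemeasurable
  calc ∫ ω, G (fun i => Y i ω) * F (fun i => Y i ω) (Y n ω) ∂μ
      = ∫ ω, G (e (H ω)) * F (e (H ω)) (Y n ω) ∂μ := by
        refine integral_congr_ae (Eventually.of_forall fun ω => ?_)
        simp only
        rw [hG _ _ (heH ω), hF _ _ (heH ω)]
    _ = ∫ p, G (e p.1) * F (e p.1) p.2 ∂(μ.map (fun ω => (H ω, Y n ω))) := by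
        rw [integral_map (hHm.prodMk (hY n)).aemeasurable
          Measurable.of_discrete.aestronglyMeasurable]
    _ = ∫ h, ∫ w, G (e h) * F (e h) w ∂(μ.map (Y n)) ∂(μ.map H) := by
        rw [hmap, integral_prod _ .of_finite]
    _ = 0 := by
        refine integral_eq_zero_of_ae (Eventually.of_forall fun h => ?_)
        simp only [Pi.zero_apply]
        rw [integral_const_mul, integral_map (hY n).aemeasurable
          Measurable.of_discrete.aestronglyMeasurable, hF0, mul_zero]

theorem measurable_of_past {Y : ℕ → Ω → W} (hY : ∀ j, Measurable (Y j)) (n : ℕ) {G : (ℕ → W) → ℝ}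
    (hG : ∀ u v : ℕ → W, (∀ i < n, u i = v i) → G u = G v) :
    Measurable fun ω => G (fun i => Y i ω) := by
  rcases isEmpty_or_nonempty Ω with hΩ | ⟨⟨ω₀⟩⟩
  · exact measurable_of_empty _
  set e : (Finset.range n → W) → ℕ → W :=
    fun h i => if hi : i ∈ Finset.range n then h ⟨i, hi⟩ else Y 0 ω₀ with he
  have h : (fun ω => G (fun i => Y i ω)) =
      (fun h => G (e h)) ∘ fun ω (i : Finset.range n) => Y i ω := by
    funext ω
    exact hG _ _ fun i hi => by simp [he, hi]
  rw [h]
  exact Measurable.of_discrete.comp (measurable_pi_lambda _ fun i => hY i)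

/-- Strong law of large numbers for bounded martingale differences that are driven by independent
samples with finitely many values. -/
theorem ae_tendsto_average_zero {Y : ℕ → Ω → W} (hY : ∀ j, Measurable (Y j))
    (hind : iIndepFun Y μ) {F : ℕ → (ℕ → W) → W → ℝ} {B : ℝ}
    (hF : ∀ n, ∀ u v : ℕ → W, (∀ i < n, u i = v i) → F n u = F n v)
    (hF0 : ∀ n u, ∫ ω, F n u (Y n ω) ∂μ = 0) (hB : ∀ n u w, |F n u w| ≤ B) :
    ∀ᵐ ω ∂μ, Tendsto (fun n : ℕ =>
      (∑ j ∈ Finset.range n, F j (fun i => Y i ω) (Y j ω)) / n) atTop (𝓝 0) := by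
  obtain ⟨ω₀⟩ : Nonempty Ω := nonempty_of_isProbabilityMeasure μ
  have hB0 : 0 ≤ B := (abs_nonneg _).trans (hB 0 (fun i => Y i ω₀) (Y 0 ω₀))
  set S : ℕ → (ℕ → W) → ℝ := fun n u => ∑ j ∈ Finset.range n, F j u (u j) with hS
  have hSd : ∀ n, ∀ u v : ℕ → W, (∀ i < n, u i = v i) → S n u = S n v := fun n u v huv => by
    refine Finset.sum_congr rfl fun j hj => ?_
    have hj' := Finset.mem_range.1 hj
    rw [hF j u v fun i hi => huv i (hi.trans hj'), huv j hj']
  have hSm : ∀ n, Measurable fun ω => S n (fun i => Y i ω) := fun n =>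
    measurable_of_past hY n (hSd n)
  have hSb : ∀ n u, |S n u| ≤ n * B := fun n u => by
    refine (Finset.abs_sum_le_sum_abs _ _).trans ?_
    refine (Finset.sum_le_sum fun j _ => hB j u (u j)).trans ?_
    simp
  -- The n-th term is S_{n+1} - S_n, a difference of functions of finitely many samples.
  have hFm : ∀ n, Measurable fun ω => F n (fun i => Y i ω) (Y n ω) := fun n => by
    have h := (hSm (n + 1)).sub (hSm n)
    have h2 : (fun ω => F n (fun i => Y i ω) (Y n ω)) =
        (fun ω => S (n + 1) fun i => Y i ω) - fun ω => S n fun i => Y i ω := by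
      funext ω
      simp [hS, Finset.sum_range_succ]
    rw [h2]
    exact h
  have hint : ∀ {f : Ω → ℝ}, Measurable f → ∀ C, (∀ ω, |f ω| ≤ C) → Integrable f μ :=
    fun hf C hC => Integrable.of_bound hf.aestronglyMeasurable C (Eventually.of_forall hC)
  have hS2i : ∀ n, Integrable (fun ω => S n (fun i => Y i ω) ^ 2) μ := fun n =>
    hint ((hSm n).pow_const 2) ((n * B) ^ 2) fun ω => by
      rw [abs_pow]
      exact pow_le_pow_left₀ (abs_nonneg _) (hSb n _) 2
  -- The increments are orthogonal to the past, so second moments add.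
  have hvar : ∀ n, ∫ ω, S n (fun i => Y i ω) ^ 2 ∂μ ≤ n * B ^ 2 := fun n => by
    induction n with
    | zero => simp [hS]
    | succ n ih =>
      have hF2 : ∀ ω, F n (fun i => Y i ω) (Y n ω) ^ 2 ≤ B ^ 2 := fun ω =>
        sq_le_sq' (abs_le.1 (hB n _ _)).1 (abs_le.1 (hB n _ _)).2
      have hF2i : Integrable (fun ω => F n (fun i => Y i ω) (Y n ω) ^ 2) μ :=
        hint ((hFm n).pow_const 2) (B ^ 2) fun ω => by
          rw [abs_of_nonneg (sq_nonneg _)]; exact hF2 ω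
      have hSFi : Integrable (fun ω => S n (fun i => Y i ω) * F n (fun i => Y i ω) (Y n ω)) μ :=
        hint ((hSm n).mul (hFm n)) (n * B * B) fun ω => by
          rw [abs_mul]
          exact mul_le_mul (hSb n _) (hB n _ _) (abs_nonneg _) (by positivity)
      have horth := integral_mul_eq_zero_of_past hY hind n (hSd n) (hF n) (hF0 n)
      have hexp : ∀ ω, S (n + 1) (fun i => Y i ω) ^ 2 = S n (fun i => Y i ω) ^ 2 +
          2 * (S n (fun i => Y i ω) * F n (fun i => Y i ω) (Y n ω)) +
          F n (fun i => Y i ω) (Y n ω) ^ 2 := fun ω => by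
        simp only [hS, Finset.sum_range_succ]
        ring
      simp only [hexp]
      have hadd : Integrable (fun ω => S n (fun i => Y i ω) ^ 2 +
          2 * (S n (fun i => Y i ω) * F n (fun i => Y i ω) (Y n ω))) μ :=
        (hS2i n).add (hSFi.const_mul 2)
      rw [integral_add hadd hF2i,
        integral_add (hS2i n) (hSFi.const_mul 2), integral_const_mul, horth]
      have h3 : ∫ ω, F n (fun i => Y i ω) (Y n ω) ^ 2 ∂μ ≤ B ^ 2 := by
        calc _ ≤ ∫ _, B ^ 2 ∂μ := integral_mono hF2i (integrable_const _) hF2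
          _ = B ^ 2 := by simp
      push_cast
      linarith
  -- Along squares the second moment of the average is at most B²/n², which is summable; so the
  -- series of squared averages is almost surely finite.
  have hsq : ∀ᵐ ω ∂μ, Tendsto (fun n : ℕ => S (n ^ 2) (fun i => Y i ω) / (n : ℝ) ^ 2) atTop
      (𝓝 0) := by
    set g : ℕ → Ω → ENNReal := fun n ω =>
      ENNReal.ofReal ((S (n ^ 2) (fun i => Y i ω) / (n : ℝ) ^ 2) ^ 2) with hg
    have hgm : ∀ n, Measurable (g n) := fun n =>
      (((hSm (n ^ 2)).div_const _).pow_const 2).ennreal_ofReal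
    have hgi : ∀ n, ∫⁻ ω, g n ω ∂μ ≤ ENNReal.ofReal (B ^ 2 * (1 / (n : ℝ) ^ 2)) := fun n => by
      have hi : Integrable (fun ω => (S (n ^ 2) (fun i => Y i ω) / (n : ℝ) ^ 2) ^ 2) μ := by
        simp only [div_pow]
        exact (hS2i (n ^ 2)).div_const _
      rw [hg, ← ofReal_integral_eq_lintegral_ofReal hi (Eventually.of_forall fun _ => sq_nonneg _)]
      refine ENNReal.ofReal_le_ofReal ?_
      simp only [div_pow]
      rw [integral_div]
      rcases Nat.eq_zero_or_pos n with rfl | hn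
      · simp
      have hn' : (0 : ℝ) < n := by exact_mod_cast hn
      rw [div_le_iff₀ (by positivity)]
      refine (hvar (n ^ 2)).trans (le_of_eq ?_)
      push_cast
      field_simp
    have hsum : ∫⁻ ω, ∑' n, g n ω ∂μ ≠ ⊤ := by
      rw [lintegral_tsum fun n => (hgm n).aemeasurable]
      refine ne_top_of_le_ne_top ?_ (ENNReal.tsum_le_tsum hgi)
      exact ((Real.summable_one_div_nat_pow.2 one_lt_two).mul_left (B ^ 2)).tsum_ofReal_ne_top
    filter_upwards [ae_lt_top (Measurable.tsum hgm) hsum] with ω hω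
    have h0 := ENNReal.tendsto_atTop_zero_of_tsum_ne_top hω.ne
    have h1 : Tendsto (fun n : ℕ => (S (n ^ 2) (fun i => Y i ω) / (n : ℝ) ^ 2) ^ 2) atTop (𝓝 0) := by
      have := (ENNReal.tendsto_toReal ENNReal.zero_ne_top).comp h0
      refine this.congr fun n => ?_
      simp only [hg, Function.comp]
      exact ENNReal.toReal_ofReal (sq_nonneg _)
    have h2 := h1.sqrt
    simp only [Real.sqrt_sq_eq_abs, Real.sqrt_zero] at h2
    exact (tendsto_zero_iff_abs_tendsto_zero _).2 h2
  filter_upwards [hsq] with ω hω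
  refine tendsto_div_of_tendsto_sq (s := fun n => S n (fun i => Y i ω)) (B := B) (fun n => ?_) hω
  simp only [hS, Finset.sum_range_succ, add_sub_cancel_left]
  exact hB n _ _

end StrongLaw

/-! ### Contracting recursions with vanishing perturbation -/

section Recursion

theorem tendsto_zero_of_le_mul_add {a b : ℕ → ℝ} {γ : ℝ} (hγ0 : 0 ≤ γ) (hγ1 : γ < 1)
    (ha : ∀ k, 0 ≤ a k) (hab : ∀ k, a (k + 1) ≤ γ * a k + b k) (hb : Tendsto b atTop (𝓝 0)) :
    Tendsto a atTop (𝓝 0) := by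
  have hγ : 0 < 1 - γ := sub_pos.2 hγ1
  refine Metric.tendsto_atTop.2 fun ε hε => ?_
  -- With this threshold, ε/2 is the fixed point of t ↦ γt + (ε/2)(1 - γ).
  obtain ⟨N, hN⟩ := eventually_atTop.1 (hb.eventually_lt_const
    (show (0 : ℝ) < ε / 2 * (1 - γ) by positivity))
  have hind : ∀ m, a (N + m) ≤ γ ^ m * a N + ε / 2 := fun m => by
    induction m with
    | zero => simp; linarith
    | succ m ih =>
      have h1 := hab (N + m)
      have h2 := hN (N + m) (Nat.le_add_right _ _)
      have h3 := mul_le_mul_of_nonneg_left ih hγ0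
      rw [← add_assoc, pow_succ]
      nlinarith
  have hlim : Tendsto (fun m => γ ^ m * a N) atTop (𝓝 (0 * a N)) :=
    (tendsto_pow_atTop_nhds_zero_of_lt_one hγ0 hγ1).mul_const _
  rw [zero_mul] at hlim
  obtain ⟨K, hK⟩ := eventually_atTop.1 (hlim.eventually_lt_const (half_pos hε))
  refine ⟨N + K, fun n hn => ?_⟩
  obtain ⟨m, rfl⟩ := Nat.exists_eq_add_of_le (le_of_add_le_left hn : N ≤ n)
  rw [Real.dist_eq, sub_zero, abs_of_nonneg (ha _)]
  linarith [hind m, hK m (by lia)]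

theorem tendsto_div_zero_of_le_mul_add {u v : ℕ → ℝ} {γ : ℝ} (hγ0 : 0 ≤ γ) (hγ1 : γ < 1)
    (hu : ∀ k, 0 ≤ u k) (huv : ∀ k, u (k + 1) ≤ γ * u k + v (k + 1))
    (hv : Tendsto (fun k : ℕ => v k / k) atTop (𝓝 0)) :
    Tendsto (fun k : ℕ => u k / k) atTop (𝓝 0) := by
  -- Index 0 is skipped: `u 0 / 0` is 0, so the divided recursion may fail there.
  refine (tendsto_add_atTop_iff_nat 1).1 ?_
  have hv' := (tendsto_add_atTop_iff_nat 1).2 ((tendsto_add_atTop_iff_nat 1).2 hv)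
  refine tendsto_zero_of_le_mul_add hγ0 hγ1 (fun k => by have := hu (k + 1); positivity)
    (fun k => ?_) hv'
  have hk : (0 : ℝ) < (k + 1 : ℕ) := by positivity
  have hk2 : ((k + 1 : ℕ) : ℝ) ≤ ((k + 1 + 1 : ℕ) : ℝ) := by push_cast; linarith
  calc u (k + 1 + 1) / ((k + 1 + 1 : ℕ) : ℝ)
      ≤ (γ * u (k + 1) + v (k + 1 + 1)) / ((k + 1 + 1 : ℕ) : ℝ) :=
        div_le_div_of_nonneg_right (huv _) (by positivity)
    _ = γ * u (k + 1) / ((k + 1 + 1 : ℕ) : ℝ) + v (k + 1 + 1) / ((k + 1 + 1 : ℕ) : ℝ) := add_div ..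
    _ ≤ γ * u (k + 1) / ((k + 1 : ℕ) : ℝ) + v (k + 1 + 1) / ((k + 1 + 1 : ℕ) : ℝ) := by
        gcongr
        exact mul_nonneg hγ0 (hu _)
    _ = _ := by rw [mul_div_assoc]

end Recursion

/-! ### Accumulated updates and their linear growth -/

section Preferences

variable {X A : Type*} [Fintype X] [Fintype A] [Nonempty A]
  [MeasurableSpace X] [DiscreteMeasurableSpace X]
  [MeasurableSpace A] [DiscreteMeasurableSpace A]

/-- The soft-max average of the preferences at round `k`. -/
noncomputable def prefsAvg (M : MDP X A) (η : ℝ) (Ψ₀ : X × A → ℝ) (y : ℕ → X × A → X) (k : ℕ) :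
    X → ℝ :=
  softmaxAvg η (prefs M η Ψ₀ y k)

/-- The accumulated sampled Bellman updates, which differ from the preferences by a function of the
state only. -/
noncomputable def cumUpdate (M : MDP X A) (η : ℝ) (Ψ₀ : X × A → ℝ) (y : ℕ → X × A → X) (k : ℕ) :
    X × A → ℝ :=
  fun z => Ψ₀ z + ∑ j ∈ Finset.range k, (M.r z + M.γ * prefsAvg M η Ψ₀ y j (y j z))

/-- The accumulated sampling noise. -/
noncomputable def cumNoise (M : MDP X A) (η : ℝ) (Ψ₀ : X × A → ℝ) (y : ℕ → X × A → X) (k : ℕ) :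
    X × A → ℝ :=
  fun z => ∑ j ∈ Finset.range k,
    (prefsAvg M η Ψ₀ y j (y j z) - ∫ x, prefsAvg M η Ψ₀ y j x ∂(M.P z))

variable (M : MDP X A) (η : ℝ) (Ψ₀ : X × A → ℝ)

/-- Causality: this is what makes the noise of round k a martingale difference. -/
theorem prefs_congr {y y' : ℕ → X × A → X} (k : ℕ) (h : ∀ i < k, y i = y' i) :
    prefs M η Ψ₀ y k = prefs M η Ψ₀ y' k := by
  induction k with
  | zero => rfl
  | succ k ih =>
    funext z
    simp only [prefs]
    rw [ih fun i hi => h i (hi.trans k.lt_succ_self), h k k.lt_succ_self]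

variable (y : ℕ → X × A → X)

theorem prefs_eq_cumUpdate_sub (k : ℕ) :
    prefs M η Ψ₀ y k =
      fun z => cumUpdate M η Ψ₀ y k z - ∑ j ∈ Finset.range k, prefsAvg M η Ψ₀ y j z.1 := by
  induction k with
  | zero => funext z; simp [prefs, cumUpdate]
  | succ k ih =>
    funext z
    have h := congr_fun ih z
    simp only [prefs, cumUpdate, Finset.sum_range_succ] at h ⊢
    rw [h]
    simp only [prefsAvg]
    ring

theorem softmax_prefs (k : ℕ) (x : X) (a : A) :
    softmax η (prefs M η Ψ₀ y k) x a = softmax η (cumUpdate M η Ψ₀ y k) x a := by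
  rw [prefs_eq_cumUpdate_sub]
  exact softmax_sub η (cumUpdate M η Ψ₀ y k)
    (fun x => ∑ j ∈ Finset.range k, prefsAvg M η Ψ₀ y j x) x a

/-- Shifting preferences by a function of the state shifts their soft-max average equally, so the
last summand cancels all earlier ones. -/
theorem sum_prefsAvg (k : ℕ) (x : X) :
    ∑ j ∈ Finset.range (k + 1), prefsAvg M η Ψ₀ y j x = softmaxAvg η (cumUpdate M η Ψ₀ y k) x := by
  have h : prefsAvg M η Ψ₀ y k x = softmaxAvg η (cumUpdate M η Ψ₀ y k) x -
      ∑ j ∈ Finset.range k, prefsAvg M η Ψ₀ y j x := by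
    rw [prefsAvg, prefs_eq_cumUpdate_sub]
    exact softmaxAvg_sub η (cumUpdate M η Ψ₀ y k)
      (fun x => ∑ j ∈ Finset.range k, prefsAvg M η Ψ₀ y j x) x
  rw [Finset.sum_range_succ, h]
  ring

theorem abs_softmaxAvg_sub_maxA_le {η : ℝ} (hη : 0 < η) (Ψ : X × A → ℝ) (x : X) :
    |softmaxAvg η Ψ x - maxA Ψ x| ≤ Fintype.card A / η := by
  rw [abs_sub_comm, abs_of_nonneg (sub_nonneg.2 (softmaxAvg_le_maxA η Ψ x))]
  linarith [maxA_le_softmaxAvg hη Ψ x]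

theorem softmaxAvg_sub_softmaxAvg_le {η : ℝ} (hη : 0 < η) {f g : X × A → ℝ} {x : X} {c : ℝ}
    (h : ∀ a, |f (x, a) - g (x, a)| ≤ c) :
    softmaxAvg η f x - softmaxAvg η g x ≤ c + Fintype.card A / η := by
  linarith [softmaxAvg_le_maxA η f x, maxA_le_softmaxAvg hη g x,
    (abs_le.1 (abs_maxA_sub_maxA_le h)).2]

-- By `sum_prefsAvg` the new average is a difference of soft-max averages of consecutive U_k. These
-- differ by at most R + γB, and soft-max costs a further C = |A|/η; B solves R + C + γB = B.
variable {η} in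
theorem abs_prefsAvg_le (hη : 0 < η) {R : ℝ} (hr : ∀ z, |M.r z| ≤ R)
    (hΨ₀ : ∀ z, |Ψ₀ z| ≤ R / (1 - M.γ)) (k : ℕ) (x : X) :
    |prefsAvg M η Ψ₀ y k x| ≤ (R + Fintype.card A / η) / (1 - M.γ) := by
  have hγ : 0 < 1 - M.γ := sub_pos.2 M.γ_lt_one
  set C : ℝ := Fintype.card A / η with hC
  have hC0 : 0 ≤ C := by positivity
  set B := (R + C) / (1 - M.γ) with hB
  have hBeq : R + C + M.γ * B = B := by rw [hB]; field_simp; ring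
  induction k generalizing x with
  | zero =>
    have h1 : |prefsAvg M η Ψ₀ y 0 x| ≤ R / (1 - M.γ) :=
      abs_le.2 ⟨le_sum_softmax_mul η Ψ₀ Ψ₀ fun a => (abs_le.1 (hΨ₀ _)).1,
        sum_softmax_mul_le η Ψ₀ Ψ₀ fun a => (abs_le.1 (hΨ₀ _)).2⟩
    exact h1.trans (div_le_div_of_nonneg_right (le_add_of_nonneg_right hC0) hγ.le)
  | succ k ih =>
    have heq : prefsAvg M η Ψ₀ y (k + 1) x =
        softmaxAvg η (cumUpdate M η Ψ₀ y (k + 1)) x - softmaxAvg η (cumUpdate M η Ψ₀ y k) x := by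
      rw [← sum_prefsAvg, ← sum_prefsAvg, Finset.sum_range_succ, add_sub_cancel_left]
    have hd : ∀ z, |cumUpdate M η Ψ₀ y (k + 1) z - cumUpdate M η Ψ₀ y k z| ≤ R + M.γ * B :=
      fun z => by
        simp only [cumUpdate, Finset.sum_range_succ]
        rw [add_sub_add_left_eq_sub, add_sub_cancel_left]
        refine (abs_add_le _ _).trans (add_le_add (hr z) ?_)
        rw [abs_mul, abs_of_nonneg M.γ_nonneg]
        exact mul_le_mul_of_nonneg_left (ih _) M.γ_nonneg
    have h1 := softmaxAvg_sub_softmaxAvg_le hη (x := x) fun a => hd (x, a)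
    have h2 := softmaxAvg_sub_softmaxAvg_le hη (x := x) fun a => (abs_sub_comm _ _).trans_le
      (hd (x, a))
    rw [heq]
    exact abs_le.2 ⟨by linarith, by linarith⟩

/-- Samples are replaced by their conditional means plus noise; `sum_prefsAvg` then closes the
recursion in U_k alone. -/
theorem cumUpdate_succ (k : ℕ) (z : X × A) :
    cumUpdate M η Ψ₀ y (k + 1) z = Ψ₀ z + (k + 1) * M.r z +
      M.γ * ∫ x, softmaxAvg η (cumUpdate M η Ψ₀ y k) x ∂(M.P z) +
      M.γ * cumNoise M η Ψ₀ y (k + 1) z := by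
  have := M.isMarkov
  simp only [← sum_prefsAvg]
  rw [integral_finsetSum _ fun _ _ => .of_finite, cumNoise, cumUpdate, Finset.sum_sub_distrib,
    Finset.sum_add_distrib, ← Finset.mul_sum, Finset.sum_const, Finset.card_range, nsmul_eq_mul]
  push_cast
  ring

theorem abs_maxA_le_norm (q : X × A → ℝ) (x : X) : |maxA q x| ≤ ‖q‖ := by
  have h : ∀ a, |q (x, a)| ≤ ‖q‖ := fun a => norm_le_pi_norm q (x, a)
  refine abs_le.2 ⟨?_, maxA_le fun a => (abs_le.1 (h a)).2⟩
  obtain ⟨a⟩ := ‹Nonempty A›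
  exact (abs_le.1 (h a)).1.trans (le_maxA q x a)

variable {η} in
theorem norm_cumUpdate_succ_sub_le (hη : 0 < η) {q : X × A → ℝ} (hq : M.bellman q = q) (k : ℕ) :
    ‖cumUpdate M η Ψ₀ y (k + 1) - ((k + 1 : ℕ) : ℝ) • q‖ ≤
      M.γ * ‖cumUpdate M η Ψ₀ y k - (k : ℝ) • q‖ +
        (‖Ψ₀‖ + (Fintype.card A / η + ‖q‖) + ‖cumNoise M η Ψ₀ y (k + 1)‖) := by
  set u := ‖cumUpdate M η Ψ₀ y k - (k : ℝ) • q‖ with hu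
  have hγ0 := M.γ_nonneg
  have hγ1 := M.γ_lt_one.le
  refine (pi_norm_le_iff_of_nonneg (by positivity)).2 fun z => ?_
  have hqz : q z = M.r z + M.γ * ∫ x, maxA q x ∂(M.P z) := (congr_fun hq z).symm
  have hk : ∀ x, |softmaxAvg η (cumUpdate M η Ψ₀ y k) x - k * maxA q x| ≤
      u + Fintype.card A / η := fun x => by
    have h1 := abs_maxA_sub_maxA_le (f := cumUpdate M η Ψ₀ y k) (g := fun z => k * q z) (x := x)
      (c := u) fun a => norm_le_pi_norm (cumUpdate M η Ψ₀ y k - (k : ℝ) • q) (x, a)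
    rw [maxA_mul k.cast_nonneg] at h1
    have h2 := abs_softmaxAvg_sub_maxA_le hη (cumUpdate M η Ψ₀ y k) x
    linarith [abs_sub_le (softmaxAvg η (cumUpdate M η Ψ₀ y k) x)
      (maxA (cumUpdate M η Ψ₀ y k) x) (k * maxA q x)]
  have h1 := abs_integral_P_sub_le M z hk
  rw [integral_const_mul] at h1
  have h2 : |∫ x, maxA q x ∂(M.P z)| ≤ ‖q‖ := by
    simpa using abs_integral_P_sub_le M z (f := maxA q) (g := 0) (c := ‖q‖)
      fun x => by simpa using abs_maxA_le_norm q x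
  have h3 : |Ψ₀ z| ≤ ‖Ψ₀‖ := norm_le_pi_norm Ψ₀ z
  have h4 : |cumNoise M η Ψ₀ y (k + 1) z| ≤ ‖cumNoise M η Ψ₀ y (k + 1)‖ :=
    norm_le_pi_norm (cumNoise M η Ψ₀ y (k + 1)) z
  set I := ∫ x, maxA q x ∂(M.P z) with hI
  set J := ∫ x, softmaxAvg η (cumUpdate M η Ψ₀ y k) x ∂(M.P z) with hJ
  -- Of the k + 1 copies of γI, k are compared with γJ; the remaining one costs at most ‖q‖.
  have heq : (cumUpdate M η Ψ₀ y (k + 1) - ((k + 1 : ℕ) : ℝ) • q) z =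
      Ψ₀ z + M.γ * (J - k * I) + -(M.γ * I) + M.γ * cumNoise M η Ψ₀ y (k + 1) z := by
    simp only [Pi.sub_apply, Pi.smul_apply, smul_eq_mul]
    rw [cumUpdate_succ, hqz]
    push_cast
    ring
  rw [Real.norm_eq_abs, heq]
  have hC0 : (0 : ℝ) ≤ Fintype.card A / η := by positivity
  have e1 : |M.γ * (J - k * I)| ≤ M.γ * u + Fintype.card A / η := by
    rw [abs_mul, abs_of_nonneg hγ0]
    nlinarith [mul_le_mul_of_nonneg_left h1 hγ0]
  have e2 : ∀ {s t : ℝ}, |s| ≤ t → |M.γ * s| ≤ t := fun {s t} h => by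
    rw [abs_mul, abs_of_nonneg hγ0]
    nlinarith [abs_nonneg s]
  have e3 := abs_add_le (Ψ₀ z + M.γ * (J - k * I) + -(M.γ * I)) (M.γ * cumNoise M η Ψ₀ y (k + 1) z)
  have e4 := abs_add_le (Ψ₀ z + M.γ * (J - k * I)) (-(M.γ * I))
  have e5 := abs_add_le (Ψ₀ z) (M.γ * (J - k * I))
  rw [abs_neg] at e4
  linarith [e2 h2, e2 h4]

variable {η} in
theorem tendsto_norm_cumUpdate_sub_div (hη : 0 < η) {q : X × A → ℝ} (hq : M.bellman q = q)
    (hE : ∀ z, Tendsto (fun k : ℕ => cumNoise M η Ψ₀ y k z / k) atTop (𝓝 0)) :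
    Tendsto (fun k : ℕ => ‖cumUpdate M η Ψ₀ y k - (k : ℝ) • q‖ / k) atTop (𝓝 0) := by
  refine tendsto_div_zero_of_le_mul_add
    (v := fun k => ‖Ψ₀‖ + (Fintype.card A / η + ‖q‖) + ‖cumNoise M η Ψ₀ y k‖)
    M.γ_nonneg M.γ_lt_one (fun _ => norm_nonneg _)
    (fun k => norm_cumUpdate_succ_sub_le M Ψ₀ y hη hq k) ?_
  have h1 : Tendsto (fun k : ℕ => (k : ℝ)⁻¹ • cumNoise M η Ψ₀ y k) atTop (𝓝 0) :=
    tendsto_pi_nhds.2 fun z => (hE z).congr fun k => by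
      rw [Pi.smul_apply, smul_eq_mul, div_eq_inv_mul]
  have h2 := (tendsto_const_div_atTop_nhds_zero_nat
    (‖Ψ₀‖ + (Fintype.card A / η + ‖q‖))).add h1.norm
  rw [norm_zero, add_zero] at h2
  refine h2.congr fun k => ?_
  rw [norm_smul, norm_inv, Real.norm_natCast, ← div_eq_inv_mul, ← add_div]

variable {η} in
theorem tendsto_Q_softmaxPolicy_prefs (hη : 0 < η) {q : X × A → ℝ} (hq : M.bellman q = q)
    (hE : ∀ z, Tendsto (fun k : ℕ => cumNoise M η Ψ₀ y k z / k) atTop (𝓝 0)) (z : X × A) :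
    Tendsto (fun k => M.Q (softmaxPolicy η (prefs M η Ψ₀ y k)) z) atTop (𝓝 (q z)) := by
  set C : ℝ := Fintype.card A / η with hC
  set u : ℕ → ℝ := fun k => ‖cumUpdate M η Ψ₀ y k - (k : ℝ) • q‖ with hu
  -- The greediness error of `mul_maxA_le_sum_softmax` with c = k and d = u_k, divided by k.
  have hδ : Tendsto (fun k : ℕ => 2 * (u k / k) + C / k) atTop (𝓝 (2 * 0 + 0)) :=
    ((tendsto_norm_cumUpdate_sub_div M Ψ₀ y hη hq hE).const_mul 2).add
      (tendsto_const_div_atTop_nhds_zero_nat C)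
  have hlow : Tendsto (fun k : ℕ => q z - M.γ * (2 * (u k / k) + C / k) / (1 - M.γ)) atTop
      (𝓝 (q z - M.γ * (2 * 0 + 0) / (1 - M.γ))) :=
    ((hδ.const_mul M.γ).div_const _).const_sub (q z)
  simp only [mul_zero, add_zero, zero_div, sub_zero] at hlow
  refine tendsto_of_tendsto_of_tendsto_of_le_of_le' hlow tendsto_const_nhds ?_
    (Eventually.of_forall fun k => Q_le_of_bellman_eq M hq _ z)
  filter_upwards [eventually_gt_atTop 0] with k hk
  have hk' : (0 : ℝ) < k := by exact_mod_cast hk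
  refine sub_le_Q_softmaxPolicy M hq η _ (fun x => ?_) z
  simp only [softmax_prefs]
  have h := mul_maxA_le_sum_softmax hη (cumUpdate M η Ψ₀ y k) q hk'.le (d := u k)
    (fun z => norm_le_pi_norm (cumUpdate M η Ψ₀ y k - (k : ℝ) • q) z) x
  rw [← hC] at h
  refine le_of_mul_le_mul_left (h.trans (le_of_eq ?_)) hk'
  field_simp

/-- The bound q on all action values is approached along `π k`, so no optimal policy has to be
constructed. -/
theorem Qstar_eq_of_tendsto {q : X × A → ℝ} (hq : M.bellman q = q) (z : X × A)
    (π : ℕ → Policy X A) (h : Tendsto (fun k => M.Q (π k) z) atTop (𝓝 (q z))) :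
    M.Qstar z = q z := by
  have : Nonempty (Policy X A) := ⟨π 0⟩
  refine le_antisymm (ciSup_le fun π => Q_le_of_bellman_eq M hq π z) ?_
  exact le_of_tendsto' h fun k =>
    le_ciSup (f := fun π => M.Q π z) ⟨q z, by rintro _ ⟨π, rfl⟩; exact Q_le_of_bellman_eq M hq π z⟩
      (π k)

end Preferences

/-! ### Sampling noise -/

section Sampling

variable {X A : Type*} [Fintype X] [Fintype A] [Nonempty A]
  [MeasurableSpace X] [DiscreteMeasurableSpace X]
  [MeasurableSpace A] [DiscreteMeasurableSpace A]

/-- The strong law is applied with the whole family of round k as a single sample, so only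
independence between rounds matters. -/
theorem ae_tendsto_cumNoise_div (M : MDP X A) {R : ℝ} (hr : ∀ z, |M.r z| ≤ R)
    {η : ℝ} (hη : 0 < η) {Ψ₀ : X × A → ℝ} (hΨ₀ : ∀ z, |Ψ₀ z| ≤ R / (1 - M.γ))
    {Ω : Type*} [MeasurableSpace Ω] {μ : Measure Ω} [IsProbabilityMeasure μ]
    {y : ℕ → X × A → Ω → X} (hy : ∀ k z, Measurable (y k z))
    (hlaw : ∀ k z, μ.map (y k z) = M.P z)
    (hindep : iIndepFun (fun k ω z => y k z ω) μ) (z : X × A) :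
    ∀ᵐ ω ∂μ, Tendsto (fun k : ℕ => cumNoise M η Ψ₀ (fun j z => y j z ω) k z / k)
      atTop (𝓝 0) := by
  have := M.isMarkov
  set B := (R + Fintype.card A / η) / (1 - M.γ) with hB
  have hD : ∀ u n x, |prefsAvg M η Ψ₀ u n x| ≤ B := fun u n x =>
    abs_prefsAvg_le M Ψ₀ u hη hr hΨ₀ n x
  refine ae_tendsto_average_zero (Y := fun k ω z => y k z ω)
    (F := fun n u w => prefsAvg M η Ψ₀ u n (w z) - ∫ x, prefsAvg M η Ψ₀ u n x ∂(M.P z))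
    (B := B + B) (fun j => measurable_pi_lambda _ fun z => hy j z) hindep ?_ ?_ ?_
  · intro n u v huv
    funext w
    simp only [prefsAvg]
    rw [prefs_congr M η Ψ₀ n huv]
  · intro n u
    have hi : Integrable (fun ω => prefsAvg M η Ψ₀ u n (y n z ω)) μ :=
      Integrable.of_bound (Measurable.of_discrete.comp (hy n z)).aestronglyMeasurable B
        (Eventually.of_forall fun ω => hD u n _)
    rw [integral_sub hi (integrable_const _), ← hlaw n z, integral_map (hy n z).aemeasurable
      Measurable.of_discrete.aestronglyMeasurable]
    simp
  · intro n u w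
    have h : |∫ x, prefsAvg M η Ψ₀ u n x ∂(M.P z)| ≤ B := by
      simpa using abs_integral_P_sub_le M z (f := prefsAvg M η Ψ₀ u n) (g := 0) (c := B)
        fun x => by simpa using hD u n x
    exact (abs_sub _ _).trans (add_le_add (hD u n _) h)

end Sampling

end DPP

theorem theorem4 {X A : Type*} [Fintype X] [Fintype A] [Nonempty A]
    [MeasurableSpace X] [DiscreteMeasurableSpace X]
    [MeasurableSpace A] [DiscreteMeasurableSpace A]
    (M : DPP.MDP X A) (Rmax : ℝ) (hRmax : 0 < Rmax) (hr : ∀ z, |M.r z| ≤ Rmax)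
    (η : ℝ) (hη : 0 < η)
    (Ψ₀ : X × A → ℝ) (hΨ₀ : ∀ z, |Ψ₀ z| ≤ Rmax / (1 - M.γ))
    {Ω : Type*} [MeasurableSpace Ω] (μ : Measure Ω) [IsProbabilityMeasure μ]
    (y : ℕ → X × A → Ω → X) (hy : ∀ k z, Measurable (y k z))
    (hlaw : ∀ k z, μ.map (y k z) = M.P z)
    (hindep : iIndepFun (fun k ω z => y k z ω) μ) :
    ∀ᵐ ω ∂μ, ∀ x : X, ∀ a : A,
      Tendsto
        (fun k : ℕ =>
          M.Q (DPP.softmaxPolicy η (DPP.prefs M η Ψ₀ (fun j z => y j z ω) k)) (x, a))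
        atTop (𝓝 (M.Qstar (x, a))) := by
  obtain ⟨q, hq⟩ := DPP.exists_bellman_fixedPoint M
  filter_upwards [ae_all_iff.2 fun z =>
    DPP.ae_tendsto_cumNoise_div M hr hη hΨ₀ hy hlaw hindep z] with ω hω x a
  have h := DPP.tendsto_Q_softmaxPolicy_prefs M Ψ₀ (fun j z => y j z ω) hη hq hω (x, a)
  rwa [DPP.Qstar_eq_of_tendsto M hq (x, a) _ h]
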